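/- Let $M$ be a non-empty Hermitian manifold of complex dimension $n\ge 2$, that is, a smooth (Hausdorff) manifold of real dimension $2n$ without boundary, with a smooth Riemannian metric $h$ and a smooth field $J$ of endomorphisms of the tangent spaces such that $J^2=-\mathrm{Id}$, $h(JX,JY)=h(X,Y)$, and the Nijenhuis tensor $N(X,Y)=[JX,JY]-J[JX,Y]-J[X,JY]-[X,Y]$ vanishes (i.e. $J$ is integrable). Let $D$ be its Chern connection: the unique connection on $TM$ for which $h$ and $J$ are parallel and the $(1,1)$-part of the torsion $T$ vanishes, i.e. $T(X,Y)+T(JX,JY)=0$. Let $R(X,Y)=D_{[X,Y]}-[D_X,D_Y]$ be its curvature, and for non-zero tangent vectors $X,Y$ at the same point let $$H^c(X,Y)=\frac{h(R(X,JX)Y,JY)}{\|X\|^2\,\|Y\|^2}$$ be the Hermitian bisectional curvature of $M$ (the holomorphic bisectional curvature of the Chern connection). Then $H^c$ is never a non-zero constant: there is no real number $c\neq 0$ such that $H^c(X,Y)=c$ for all points of $M$ and all non-zero tangent vectors $X,Y$ at that point. -/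

import Mathlib

open Bundle VectorField
open scoped Manifold ContDiff

noncomputable section

namespace HermitianGeometry

variable {E : Type*} [NormedAddCommGroup E] [NormedSpace ℝ E]
  {M : Type*} [TopologicalSpace M] [ChartedSpace E M]

/-- A smooth (globally defined) vector field on the manifold `M` without boundary. -/
def SmoothField [IsManifold 𝓘(ℝ, E) ∞ M] (X : (x : M) → TangentSpace 𝓘(ℝ, E) x) : Prop :=
  ContMDiff 𝓘(ℝ, E) 𝓘(ℝ, E).tangent ∞ (fun x ↦ (⟨x, X x⟩ : TangentBundle 𝓘(ℝ, E) M))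

/-- The vector field `J X`, for a field `J` of endomorphisms of the tangent spaces. -/
def applyField
    (J : (x : M) → TangentSpace 𝓘(ℝ, E) x →L[ℝ] TangentSpace 𝓘(ℝ, E) x)
    (X : (x : M) → TangentSpace 𝓘(ℝ, E) x) : (x : M) → TangentSpace 𝓘(ℝ, E) x :=
  fun x ↦ J x (X x)

/-- The field `J` of endomorphisms of the tangent spaces of `M` and the Riemannian metric of `M`
form a Hermitian structure: `J` is a smooth almost complex structure, orthogonal for the metric
and integrable, i.e. with vanishing Nijenhuis tensor
`N(X, Y) = [JX, JY] - J[JX, Y] - J[X, JY] - [X, Y]`. -/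
structure IsHermitianStructure [IsManifold 𝓘(ℝ, E) ∞ M]
    [RiemannianBundle (fun x : M ↦ TangentSpace 𝓘(ℝ, E) x)]
    (J : (x : M) → TangentSpace 𝓘(ℝ, E) x →L[ℝ] TangentSpace 𝓘(ℝ, E) x) : Prop where
  smooth : ContMDiff 𝓘(ℝ, E) (𝓘(ℝ, E).prod 𝓘(ℝ, E →L[ℝ] E)) ∞
    (fun x ↦ TotalSpace.mk' (E →L[ℝ] E)
      (E := fun x : M ↦ TangentSpace 𝓘(ℝ, E) x →L[ℝ] TangentSpace 𝓘(ℝ, E) x) x (J x))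
  sq_eq_neg : ∀ (x : M) (v : TangentSpace 𝓘(ℝ, E) x), J x (J x v) = -v
  orthogonal : ∀ (x : M) (v w : TangentSpace 𝓘(ℝ, E) x),
    inner ℝ (J x v) (J x w) = inner ℝ v w
  nijenhuis_eq_zero : ∀ X Y : (x : M) → TangentSpace 𝓘(ℝ, E) x,
    SmoothField X → SmoothField Y → ∀ x : M,
      mlieBracket 𝓘(ℝ, E) (applyField J X) (applyField J Y) x
        - J x (mlieBracket 𝓘(ℝ, E) (applyField J X) Y x)
        - J x (mlieBracket 𝓘(ℝ, E) X (applyField J Y) x)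
        - mlieBracket 𝓘(ℝ, E) X Y x = 0

/-- The connection `D` on the tangent bundle is the Chern connection of the almost Hermitian
manifold `M`: it is a smooth connection for which the metric and the almost complex structure `J`
are parallel, and the `(1,1)`-part `(T(u, v) + T(Ju, Jv)) / 2` of its torsion `T` vanishes.
(`D Y x u` is the covariant derivative `(D_u Y)(x)`.) -/
structure IsChernConnection [FiniteDimensional ℝ E] [IsManifold 𝓘(ℝ, E) ∞ M]
    [RiemannianBundle (fun x : M ↦ TangentSpace 𝓘(ℝ, E) x)]
    [IsContMDiffRiemannianBundle 𝓘(ℝ, E) ∞ E (fun x : M ↦ TangentSpace 𝓘(ℝ, E) x)]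
    (J : (x : M) → TangentSpace 𝓘(ℝ, E) x →L[ℝ] TangentSpace 𝓘(ℝ, E) x)
    (D : CovariantDerivative 𝓘(ℝ, E) E (fun x : M ↦ TangentSpace 𝓘(ℝ, E) x)) : Prop where
  smooth : D.ContMDiffCovariantDerivative ∞
  metric_parallel : ∀ Y Z : (x : M) → TangentSpace 𝓘(ℝ, E) x, SmoothField Y → SmoothField Z →
    ∀ (x : M) (u : TangentSpace 𝓘(ℝ, E) x),
      mvfderiv 𝓘(ℝ, E) (fun y ↦ inner ℝ (Y y) (Z y)) x u
        = inner ℝ (D Y x u) (Z x) + inner ℝ (Y x) (D Z x u)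
  complex_parallel : ∀ Y : (x : M) → TangentSpace 𝓘(ℝ, E) x, SmoothField Y →
    ∀ (x : M) (u : TangentSpace 𝓘(ℝ, E) x), D (applyField J Y) x u = J x (D Y x u)
  torsion_one_one : ∀ (x : M) (u v : TangentSpace 𝓘(ℝ, E) x),
    D.torsion x u v + D.torsion x (J x u) (J x v) = 0

/-- The curvature `R(X, Y)Z = D_{[X, Y]} Z - (D_X D_Y Z - D_Y D_X Z)` of a connection `D` on the
tangent bundle. -/
def curvature [IsManifold 𝓘(ℝ, E) ∞ M]
    (D : CovariantDerivative 𝓘(ℝ, E) E (fun x : M ↦ TangentSpace 𝓘(ℝ, E) x))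
    (X Y Z : (x : M) → TangentSpace 𝓘(ℝ, E) x) : (x : M) → TangentSpace 𝓘(ℝ, E) x :=
  fun x ↦ D Z x (mlieBracket 𝓘(ℝ, E) X Y x)
    - (D (fun y ↦ D Z y (Y y)) x (X x) - D (fun y ↦ D Z y (X y)) x (Y x))

/-- The holomorphic bisectional curvature `⟨R(X, JX)Y, JY⟩ / (‖X‖² ‖Y‖²)` of a connection `D`,
at a point `x` where the smooth vector fields `X` and `Y` do not vanish. As `R` is a tensor, it
depends only on the tangent vectors `X x` and `Y x`. -/
def bisectionalCurvature [IsManifold 𝓘(ℝ, E) ∞ M]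
    [RiemannianBundle (fun x : M ↦ TangentSpace 𝓘(ℝ, E) x)]
    (J : (x : M) → TangentSpace 𝓘(ℝ, E) x →L[ℝ] TangentSpace 𝓘(ℝ, E) x)
    (D : CovariantDerivative 𝓘(ℝ, E) E (fun x : M ↦ TangentSpace 𝓘(ℝ, E) x))
    (X Y : (x : M) → TangentSpace 𝓘(ℝ, E) x) (x : M) : ℝ :=
  inner ℝ (curvature D X (applyField J X) Y x) (J x (Y x)) / (‖X x‖ ^ 2 * ‖Y x‖ ^ 2)

/-- The Hermitian bisectional curvature is constant, equal to `c`: the bisectional curvature of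
the Chern connection `D` has the value `c` on all pairs of non-zero tangent vectors at all points. -/
def HasConstantBisectionalCurvature [IsManifold 𝓘(ℝ, E) ∞ M]
    [RiemannianBundle (fun x : M ↦ TangentSpace 𝓘(ℝ, E) x)]
    (J : (x : M) → TangentSpace 𝓘(ℝ, E) x →L[ℝ] TangentSpace 𝓘(ℝ, E) x)
    (D : CovariantDerivative 𝓘(ℝ, E) E (fun x : M ↦ TangentSpace 𝓘(ℝ, E) x)) (c : ℝ) : Prop :=
  ∀ X Y : (x : M) → TangentSpace 𝓘(ℝ, E) x, SmoothField X → SmoothField Y →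
    ∀ x : M, X x ≠ 0 → Y x ≠ 0 → bisectionalCurvature J D X Y x = c

end HermitianGeometry

end

/-!
Since `J` is parallel and the torsion has no `(1,1)`-part, the `(0,1)`-part of the Chern connection
is the Dolbeault operator `[X, Y] + J[JX, Y]`. Integrability makes the Dolbeault operator square to
zero, so the curvature is of type `(1,1)`. If the bisectional curvature is the constant `c`,
polarization then gives `R(X, Y) = c ω(X, Y) J`, where `ω` is the fundamental two-form.

For `c ≠ 0` the second Bianchi identity shows that `ω` is closed, i.e. that the cyclic sum of
`ω(X, T(Y, Z))` vanishes; as the torsion `T` is complex bilinear, it must vanish itself. The first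
Bianchi identity becomes `ω(X, Y) Z + ω(Y, Z) X + ω(Z, X) Y = 0`. Taking `Y = JX` puts every `Z` in
the span of `X` and `JX`, which is impossible in complex dimension at least two.
-/

noncomputable section

namespace HermitianGeometry

section Bianchi

variable {R L : Type*} [CommRing R] [LieRing L] [LieAlgebra R L]

/-- The curvature of a connection `D`, given as the map `X ↦ D_X`, with the sign convention
`R(X, Y) = D_{[X, Y]} - [D_X, D_Y]`. -/
def curvatureForm (D : L →ₗ[R] Module.End R L) : L →ₗ[R] L →ₗ[R] Module.End R L :=
  LinearMap.mk₂ R (fun X Y ↦ D ⁅X, Y⁆ - (D X * D Y - D Y * D X))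
    (fun X X' Y ↦ by simp only [add_lie, map_add, add_mul, mul_add]; abel)
    (fun c X Y ↦ by simp only [smul_lie, map_smul, smul_sub, smul_mul_assoc, mul_smul_comm])
    (fun X Y Y' ↦ by simp only [lie_add, map_add, add_mul, mul_add]; abel)
    (fun c X Y ↦ by simp only [lie_smul, map_smul, smul_sub, smul_mul_assoc, mul_smul_comm])

/-- The torsion of a connection, the obstruction to the first Bianchi identity. -/
def torsionForm (D : L →ₗ[R] Module.End R L) : L →ₗ[R] L →ₗ[R] L :=
  LinearMap.mk₂ R (fun X Y ↦ D X Y - D Y X - ⁅X, Y⁆)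
    (fun X X' Y ↦ by simp only [add_lie, map_add, LinearMap.add_apply]; abel)
    (fun c X Y ↦ by simp only [smul_lie, map_smul, LinearMap.smul_apply, smul_sub])
    (fun X Y Y' ↦ by simp only [lie_add, map_add, LinearMap.add_apply]; abel)
    (fun c X Y ↦ by simp only [lie_smul, map_smul, LinearMap.smul_apply, smul_sub])

variable (D : L →ₗ[R] Module.End R L) (X Y Z W : L)

lemma curvatureForm_eq_sub_commutator :
    curvatureForm D X Y = D ⁅X, Y⁆ - (D X * D Y - D Y * D X) := rfl

lemma curvatureForm_apply :
    curvatureForm D X Y Z = D ⁅X, Y⁆ Z - (D X (D Y Z) - D Y (D X Z)) := rfl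

lemma torsionForm_apply : torsionForm D X Y = D X Y - D Y X - ⁅X, Y⁆ := rfl

lemma curvatureForm_swap : curvatureForm D X Y = -curvatureForm D Y X := by
  rw [curvatureForm_eq_sub_commutator, curvatureForm_eq_sub_commutator, ← lie_skew X Y, map_neg]
  abel

theorem first_bianchi :
    curvatureForm D X Y Z + curvatureForm D Y Z X + curvatureForm D Z X Y =
      (torsionForm D ⁅X, Y⁆ Z - D X (torsionForm D Y Z))
        + (torsionForm D ⁅Y, Z⁆ X - D Y (torsionForm D Z X))
        + (torsionForm D ⁅Z, X⁆ Y - D Z (torsionForm D X Y)) := by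
  have jacobi := lie_jacobi X Y Z
  rw [← lie_skew X ⁅Y, Z⁆, ← lie_skew Y ⁅Z, X⁆, ← lie_skew Z ⁅X, Y⁆] at jacobi
  simp only [curvatureForm_apply, torsionForm_apply, map_sub]
  linear_combination (norm := abel) -jacobi

theorem second_bianchi :
    (curvatureForm D X ⁅Y, Z⁆ W + (D X (curvatureForm D Y Z W) - curvatureForm D Y Z (D X W)))
      + (curvatureForm D Y ⁅Z, X⁆ W + (D Y (curvatureForm D Z X W) - curvatureForm D Z X (D Y W)))
      + (curvatureForm D Z ⁅X, Y⁆ W + (D Z (curvatureForm D X Y W) - curvatureForm D X Y (D Z W)))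
      = 0 := by
  have jacobi := congrArg (fun U ↦ D U W) (lie_jacobi X Y Z)
  simp only [map_add, map_zero, LinearMap.add_apply, LinearMap.zero_apply] at jacobi
  simp only [curvatureForm_apply, map_sub]
  linear_combination (norm := abel) jacobi

end Bianchi

section Dolbeault

variable {R A L : Type*} [CommRing R] [CommRing A] [LieRing L] [LieAlgebra R L] [Module A L]

/-- An integrable almost complex structure on a Lie algebra `L` of vector fields; `A` stands for the
ring of functions, which need not act compatibly with the bracket here. -/
structure IsIntegrableComplexStructure (J : L →ₗ[A] L) : Prop where
  sq_eq_neg (X : L) : J (J X) = -X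
  nijenhuis_eq_zero (X Y : L) : ⁅J X, J Y⁆ - J ⁅J X, Y⁆ - J ⁅X, J Y⁆ - ⁅X, Y⁆ = 0

/-- A connection that preserves the complex structure `J` and whose torsion has no `(1,1)`-part;
this forces its `(0,1)`-part to be the Dolbeault operator. -/
structure IsDolbeaultConnection (J : L →ₗ[A] L) (D : L →ₗ[R] Module.End R L) : Prop where
  complex_parallel (X Y : L) : D X (J Y) = J (D X Y)
  torsion_one_one (X Y : L) : torsionForm D X Y + torsionForm D (J X) (J Y) = 0

/-- The Dolbeault operator on vector fields, normalized as twice the `∂̄`-derivative of `Y` along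
the `(0,1)`-part of `X`. -/
def dolbeault (J : L →ₗ[A] L) (X Y : L) : L := ⁅X, Y⁆ + J ⁅J X, Y⁆

namespace IsIntegrableComplexStructure

variable {J : L →ₗ[A] L} (hJ : IsIntegrableComplexStructure J) (X Y Z : L)
include hJ

lemma lie_apply_add_lie_apply : ⁅J X, Y⁆ + ⁅X, J Y⁆ = J (⁅X, Y⁆ - ⁅J X, J Y⁆) := by
  have h := congrArg J (hJ.nijenhuis_eq_zero X Y)
  simp only [map_sub, hJ.sq_eq_neg, map_zero] at h ⊢
  linear_combination (norm := abel) h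

lemma dolbeault_apply : dolbeault J X (J Y) = J (dolbeault J X Y) := by
  have h := hJ.lie_apply_add_lie_apply X Y
  simp only [dolbeault, map_add, map_sub, hJ.sq_eq_neg] at h ⊢
  linear_combination (norm := abel) h

lemma dolbeault_commutator :
    dolbeault J X (dolbeault J Y Z) - dolbeault J Y (dolbeault J X Z) =
      dolbeault J (⁅X, Y⁆ - ⁅J X, J Y⁆) Z := by
  have expand (X Y : L) : dolbeault J X (dolbeault J Y Z) =
      ⁅X, ⁅Y, Z⁆⁆ - ⁅J X, ⁅J Y, Z⁆⁆ + J (⁅J X, ⁅Y, Z⁆⁆ + ⁅X, ⁅J Y, Z⁆⁆) := by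
    have h := hJ.dolbeault_apply X ⁅J Y, Z⁆
    simp only [dolbeault, lie_add, map_add, hJ.sq_eq_neg] at h ⊢
    linear_combination (norm := abel) h
  rw [expand X Y, expand Y X, dolbeault, ← hJ.lie_apply_add_lie_apply]
  simp only [sub_lie, add_lie, lie_lie, map_add, map_sub]
  abel

end IsIntegrableComplexStructure

namespace IsDolbeaultConnection

variable {J : L →ₗ[A] L} {D : L →ₗ[R] Module.End R L} (hD : IsDolbeaultConnection J D)
  (hJ : IsIntegrableComplexStructure J) (X Y Z : L)
include hD

lemma torsionForm_apply_apply : torsionForm D (J X) (J Y) = -torsionForm D X Y :=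
  eq_neg_of_add_eq_zero_right (hD.torsion_one_one X Y)

include hJ

lemma torsionForm_apply_right_eq_left : torsionForm D X (J Y) = torsionForm D (J X) Y := by
  have h := hD.torsionForm_apply_apply (J X) Y
  rwa [hJ.sq_eq_neg, map_neg, LinearMap.neg_apply, neg_inj] at h

variable [IsAddTorsionFree L]

lemma torsionForm_apply_left : torsionForm D (J X) Y = J (torsionForm D X Y) := by
  have hN : J (torsionForm D (J X) Y + torsionForm D X (J Y)) =
      torsionForm D (J X) (J Y) - torsionForm D X Y := by
    have h := hJ.nijenhuis_eq_zero X Y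
    simp only [torsionForm_apply, hD.complex_parallel, map_add, map_sub, hJ.sq_eq_neg] at h ⊢
    linear_combination (norm := abel) h
  rw [hD.torsionForm_apply_right_eq_left hJ, hD.torsionForm_apply_apply] at hN
  have h : 2 • (J (torsionForm D (J X) Y) + torsionForm D X Y) = 0 := by
    rw [map_add] at hN
    linear_combination (norm := abel) hN
  have h := congrArg J ((smul_eq_zero_iff_right two_ne_zero).1 h)
  rw [map_add, hJ.sq_eq_neg, map_zero] at h
  linear_combination (norm := abel) -h

lemma torsionForm_apply_right : torsionForm D X (J Y) = J (torsionForm D X Y) := by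
  rw [hD.torsionForm_apply_right_eq_left hJ, hD.torsionForm_apply_left hJ]

lemma add_apply_eq_dolbeault : D X Y + J (D (J X) Y) = dolbeault J X Y := by
  have h : torsionForm D X Y + J (torsionForm D (J X) Y) = 0 := by
    rw [hD.torsionForm_apply_left hJ, hJ.sq_eq_neg, add_neg_cancel]
  simp only [torsionForm_apply, map_sub, hD.complex_parallel, hJ.sq_eq_neg] at h
  rw [dolbeault]
  linear_combination (norm := abel) h

theorem curvatureForm_zero_two :
    curvatureForm D X Y Z - curvatureForm D (J X) (J Y) Z
      + J (curvatureForm D (J X) Y Z + curvatureForm D X (J Y) Z) = 0 := by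
  have h := hJ.dolbeault_commutator X Y Z
  simp only [← hD.add_apply_eq_dolbeault hJ, ← hJ.lie_apply_add_lie_apply,
    map_add, map_sub, hD.complex_parallel, hJ.sq_eq_neg, LinearMap.add_apply, LinearMap.sub_apply]
    at h
  simp only [curvatureForm_apply, map_add, map_sub]
  linear_combination (norm := abel) -h

end IsDolbeaultConnection

end Dolbeault

section Polarization

variable {G N : Type*} [AddCommGroup G] [AddCommGroup N] [IsAddTorsionFree N]

lemma eq_zero_of_add_left_of_symm_of_self {f : G → G → N}
    (add_left : ∀ x y z, f (x + y) z = f x z + f y z) (symm : ∀ x y, f x y = f y x)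
    (self : ∀ x, f x x = 0) (x y : G) : f x y = 0 := by
  have h := self (x + y)
  rw [add_left, symm x, symm y, add_left, add_left, self, self, zero_add, add_zero, symm y x,
    ← two_nsmul] at h
  exact (smul_eq_zero_iff_right two_ne_zero).1 h

lemma eq_zero_of_parallelogram_of_forall_notMem {q : G → N}
    (parallelogram : ∀ x y, q (x + y) + q (x - y) = 2 • q x + 2 • q y) {S : AddSubgroup G}
    (hS : S ≠ ⊤) (h : ∀ x ∉ S, q x = 0) (x : G) : q x = 0 := by
  by_cases hx : x ∈ S
  · obtain ⟨y, hy⟩ := SetLike.exists_not_mem_of_ne_top S hS rfl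
    have hq := parallelogram y x
    rw [h y hy, h _ fun hs ↦ hy ((S.add_mem_cancel_right hx).1 hs),
      h _ fun hs ↦ hy (by simpa only [sub_add_cancel] using S.add_mem hs hx),
      add_zero, smul_zero, zero_add] at hq
    exact (smul_eq_zero_iff_right two_ne_zero).1 hq.symm
  · exact h x hx

end Polarization

section HermitianForm

variable {A L : Type*} [CommRing A] [AddCommGroup L] [Module A L]

/-- A nondegenerate symmetric form `g` for which the almost complex structure `J` is orthogonal;
no positivity is imposed. -/
structure IsHermitianForm (g : L →ₗ[A] L →ₗ[A] A) (J : L →ₗ[A] L) : Prop where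
  sq_eq_neg (X : L) : J (J X) = -X
  symm (X Y : L) : g X Y = g Y X
  orthogonal (X Y : L) : g (J X) (J Y) = g X Y
  separatingLeft : g.SeparatingLeft

/-- The fundamental two-form `ω(X, Y) = g(JX, Y)` of a Hermitian form. -/
def kahlerForm (g : L →ₗ[A] L →ₗ[A] A) (J : L →ₗ[A] L) : L →ₗ[A] L →ₗ[A] A := g ∘ₗ J

variable {g : L →ₗ[A] L →ₗ[A] A} {J : L →ₗ[A] L}

lemma kahlerForm_apply (X Y : L) : kahlerForm g J X Y = g (J X) Y := rfl

namespace IsHermitianForm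

variable (hg : IsHermitianForm g J)
include hg

lemma eq_of_forall_apply_eq {X Y : L} (h : ∀ Z, g X Z = g Y Z) : X = Y :=
  sub_eq_zero.1 (hg.separatingLeft _ fun Z ↦ by rw [map_sub, LinearMap.sub_apply, h, sub_self])

lemma complex_left (X Y : L) : g (J X) Y = -g X (J Y) := by
  rw [← hg.orthogonal X, hg.sq_eq_neg, map_neg, neg_neg]

lemma kahlerForm_swap (X Y : L) : kahlerForm g J X Y = -kahlerForm g J Y X := by
  rw [kahlerForm_apply, kahlerForm_apply, hg.complex_left, hg.symm]

lemma kahlerForm_apply_apply (X Y : L) : kahlerForm g J (J X) (J Y) = kahlerForm g J X Y := by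
  rw [kahlerForm_apply, kahlerForm_apply, hg.orthogonal]

end IsHermitianForm

end HermitianForm

section ChernConnection

variable {K A L : Type*} [CommRing K] [CommRing A] [LieRing L] [LieAlgebra K L] [Module A L]

/-- A connection for which `g` is parallel, obeying the Leibniz rule for functions `f : A`, which
vector fields differentiate by `⁅X, f⁆`. Linearity of `X ↦ D_X` over `A` is not imposed. -/
structure IsMetricConnection [LieRingModule L A] (g : L →ₗ[A] L →ₗ[A] A)
    (D : L →ₗ[K] Module.End K L) : Prop where
  leibniz (X Y : L) (f : A) : D X (f • Y) = f • D X Y + ⁅X, f⁆ • Y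
  metric_parallel (X Y Z : L) : ⁅X, g Y Z⁆ = g (D X Y) Z + g Y (D X Z)

/-- A Chern connection over a Lie algebra of vector fields, together with the Hermitian structure
it belongs to. -/
structure IsAlgebraicChernConnection [LieRingModule L A] (g : L →ₗ[A] L →ₗ[A] A) (J : L →ₗ[A] L)
    (D : L →ₗ[K] Module.End K L) : Prop extends
    IsIntegrableComplexStructure J, IsHermitianForm g J, IsDolbeaultConnection J D,
    IsMetricConnection g D

variable {g : L →ₗ[A] L →ₗ[A] A} {J : L →ₗ[A] L} {D : L →ₗ[K] Module.End K L}

lemma IsDolbeaultConnection.curvatureForm_apply_complex (hD : IsDolbeaultConnection J D)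
    (X Y Z : L) : curvatureForm D X Y (J Z) = J (curvatureForm D X Y Z) := by
  simp only [curvatureForm_apply, hD.complex_parallel, map_sub]

variable [LieRingModule L A]

lemma IsMetricConnection.curvatureForm_skew (hD : IsMetricConnection g D)
    (X Y Z W : L) : g (curvatureForm D X Y Z) W = -g Z (curvatureForm D X Y W) := by
  have h := lie_lie X Y (g Z W)
  simp only [hD.metric_parallel, lie_add] at h
  simp only [curvatureForm_apply, map_sub, LinearMap.sub_apply]
  linear_combination h

namespace IsAlgebraicChernConnection

variable (h : IsAlgebraicChernConnection g J D)
include h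

lemma lie_kahlerForm (X Y Z : L) :
    ⁅X, kahlerForm g J Y Z⁆ = kahlerForm g J (D X Y) Z + kahlerForm g J Y (D X Z) := by
  simp only [kahlerForm_apply, h.metric_parallel, h.complex_parallel]

theorem exterior_kahlerForm (X Y Z : L) :
    (⁅X, kahlerForm g J Y Z⁆ + kahlerForm g J X ⁅Y, Z⁆)
      + (⁅Y, kahlerForm g J Z X⁆ + kahlerForm g J Y ⁅Z, X⁆)
      + (⁅Z, kahlerForm g J X Y⁆ + kahlerForm g J Z ⁅X, Y⁆) =
    -(kahlerForm g J X (torsionForm D Y Z) + kahlerForm g J Y (torsionForm D Z X)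
      + kahlerForm g J Z (torsionForm D X Y)) := by
  simp only [torsionForm_apply, map_sub, h.lie_kahlerForm, h.kahlerForm_swap (D _ _)]
  ring

theorem curvatureForm_one_one [IsAddTorsionFree L] [IsAddTorsionFree A] (X Y Z : L) :
    curvatureForm D (J X) (J Y) Z = curvatureForm D X Y Z := by
  let S := curvatureForm D X Y - curvatureForm D (J X) (J Y)
  let T := curvatureForm D (J X) Y + curvatureForm D X (J Y)
  have S_eq (Z : L) : S Z = -J (T Z) :=
    eq_neg_of_add_eq_zero_left (h.curvatureForm_zero_two h.toIsIntegrableComplexStructure X Y Z)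
  have S_skew (Z W : L) : g (S Z) W = -g Z (S W) := by
    simp only [S, LinearMap.sub_apply, map_sub, h.curvatureForm_skew _ _ Z W]
    ring
  have T_skew (Z W : L) : g (T Z) W = -g Z (T W) := by
    simp only [T, LinearMap.add_apply, map_add, h.curvatureForm_skew _ _ Z W]
    ring
  have T_complex (Z : L) : T (J Z) = J (T Z) := by
    simp only [T, LinearMap.add_apply, map_add, h.curvatureForm_apply_complex]
  have S_symm (Z W : L) : g (S Z) W = g Z (S W) := by
    rw [S_eq, S_eq, map_neg, LinearMap.neg_apply, h.complex_left, neg_neg, T_skew, T_complex,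
      map_neg]
  refine (sub_eq_zero.1 (h.separatingLeft _ fun W ↦ self_eq_neg.1 ?_)).symm
  exact (S_skew Z W).trans (congrArg Neg.neg (S_symm Z W).symm)

section ConstantBisectionalCurvature

variable [IsAddTorsionFree L] [IsAddTorsionFree A] [Algebra K A] {c : K}
  (hc : ∀ X Y, g (curvatureForm D X (J X) Y) (J Y) = c • (g X X * g Y Y))
include hc

lemma inner_curvatureForm_apply_complex (X Y Z W : L) :
    g (curvatureForm D X (J Y) Z) (J W) = c • (g X Y * g Z W) := by
  have polarized_right (X Z W : L) :
      g (curvatureForm D X (J X) Z) (J W) - c • (g X X * g Z W) = 0 := by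
    refine eq_zero_of_add_left_of_symm_of_self (f := fun Z W ↦
      g (curvatureForm D X (J X) Z) (J W) - c • (g X X * g Z W)) (fun Z Z' W ↦ ?_)
      (fun Z W ↦ ?_) (fun Z ↦ sub_eq_zero.2 (hc X Z)) Z W
    · simp only [map_add, LinearMap.add_apply, mul_add, smul_add]
      abel
    · rw [h.curvatureForm_skew, h.curvatureForm_apply_complex, h.symm Z W, h.symm Z,
        h.complex_left, neg_neg]
  refine sub_eq_zero.1 (eq_zero_of_add_left_of_symm_of_self (f := fun X Y ↦
    g (curvatureForm D X (J Y) Z) (J W) - c • (g X Y * g Z W)) (fun X X' Y ↦ ?_)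
    (fun X Y ↦ ?_) (fun X ↦ polarized_right X Z W) X Y)
  · simp only [map_add, LinearMap.add_apply, add_mul, smul_add]
    abel
  · rw [← h.curvatureForm_one_one, h.sq_eq_neg, map_neg, ← curvatureForm_swap, h.symm Y X]

theorem curvatureForm_eq_smul_complex [IsScalarTower K A L] (X Y Z : L) :
    curvatureForm D X Y Z = c • kahlerForm g J X Y • J Z := by
  refine h.eq_of_forall_apply_eq fun W ↦ ?_
  have key := h.inner_curvatureForm_apply_complex hc X (J Y) Z (J W)
  simp only [h.sq_eq_neg, map_neg, LinearMap.neg_apply, neg_neg] at key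
  rw [kahlerForm_apply, key, ← algebraMap_smul A c, ← algebraMap_smul A c]
  simp only [map_smul, LinearMap.smul_apply, h.complex_left, smul_eq_mul]
  ring

end ConstantBisectionalCurvature

section KahlerCurvature

variable [Algebra K A] [IsScalarTower K A L] [FaithfulSMul A L] {c : K} (hc : IsUnit c)
  (hR : ∀ X Y Z, curvatureForm D X Y Z = c • kahlerForm g J X Y • J Z)
include hc hR

theorem kahlerForm_closed (X Y Z : L) :
    (⁅X, kahlerForm g J Y Z⁆ + kahlerForm g J X ⁅Y, Z⁆)
      + (⁅Y, kahlerForm g J Z X⁆ + kahlerForm g J Y ⁅Z, X⁆)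
      + (⁅Z, kahlerForm g J X Y⁆ + kahlerForm g J Z ⁅X, Y⁆) = 0 := by
  have covariant_derivative (X Y Z W : L) : D X (curvatureForm D Y Z (J W)) -
      curvatureForm D Y Z (D X (J W)) = -(c • ⁅X, kahlerForm g J Y Z⁆ • W) := by
    simp only [hR, h.complex_parallel, h.sq_eq_neg, smul_neg, map_neg, map_smul, h.leibniz]
    module
  refine FaithfulSMul.eq_of_smul_eq_smul (α := L) fun W ↦ hc.smul_left_cancel.1 ?_
  have bianchi := second_bianchi D X Y Z (J W)
  simp only [covariant_derivative] at bianchi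
  simp only [hR, h.sq_eq_neg, smul_neg] at bianchi
  rw [zero_smul, smul_zero, ← neg_eq_zero, ← bianchi]
  module

variable [IsAddTorsionFree L] [IsAddTorsionFree A]

theorem torsionForm_eq_zero (X Y : L) : torsionForm D X Y = 0 := by
  have hJ := h.toIsIntegrableComplexStructure
  have cyclic (X Y Z : L) : kahlerForm g J X (torsionForm D Y Z)
      + kahlerForm g J Y (torsionForm D Z X) + kahlerForm g J Z (torsionForm D X Y) = 0 := by
    rw [← neg_eq_zero, ← h.exterior_kahlerForm, h.kahlerForm_closed hc hR]
  have kahlerForm_torsion (W : L) : kahlerForm g J W (torsionForm D X Y) = 0 := by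
    -- Passing from `(X, Y)` to `(JX, JY)` negates only the first term of the cyclic sum.
    have twisted := cyclic W (J X) (J Y)
    simp only [h.torsionForm_apply_left hJ, h.torsionForm_apply_right hJ, h.sq_eq_neg,
      h.kahlerForm_apply_apply, map_neg] at twisted
    refine self_eq_neg.1 ?_
    linear_combination cyclic W X Y - twisted
  refine h.separatingLeft _ fun W ↦ ?_
  rw [h.symm, ← neg_eq_zero, ← LinearMap.neg_apply, ← map_neg, ← h.sq_eq_neg, ← kahlerForm_apply,
    kahlerForm_torsion]

theorem kahlerForm_smul_cyclic (X Y Z : L) :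
    kahlerForm g J X Y • Z + kahlerForm g J Y Z • X + kahlerForm g J Z X • Y = 0 := by
  have bianchi := congrArg J (first_bianchi D X Y Z)
  simp only [h.torsionForm_eq_zero hc hR, map_zero, sub_zero, add_zero, hR] at bianchi
  rw [← hc.smul_eq_zero, ← neg_eq_zero, ← bianchi]
  simp only [map_add, map_smul, ← algebraMap_smul A c, h.sq_eq_neg]
  module

theorem self_smul_eq_add (X Z : L) : g X X • Z = g X Z • X + g (J X) Z • J X := by
  have cyclic := h.kahlerForm_smul_cyclic hc hR X (J X) Z
  simp only [h.kahlerForm_swap Z, kahlerForm_apply, h.sq_eq_neg, h.orthogonal, map_neg,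
    LinearMap.neg_apply, neg_smul] at cyclic
  linear_combination (norm := module) cyclic

end KahlerCurvature

end IsAlgebraicChernConnection

end ChernConnection


section SmoothSections

variable {𝕜 : Type*} [NontriviallyNormedField 𝕜]
  {E : Type*} [NormedAddCommGroup E] [NormedSpace 𝕜 E] {H : Type*} [TopologicalSpace H]
  {I : ModelWithCorners 𝕜 E H} {M : Type*} [TopologicalSpace M] [ChartedSpace H M]
  {F : Type*} [NormedAddCommGroup F] [NormedSpace 𝕜 F] {n : WithTop ℕ∞}
  {V : M → Type*} [TopologicalSpace (TotalSpace F V)] [∀ x, AddCommGroup (V x)]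
  [∀ x, Module 𝕜 (V x)] [∀ x, TopologicalSpace (V x)] [FiberBundle F V] [VectorBundle 𝕜 F V]

instance : SMul C^n⟮I, M; 𝕜⟯ Cₛ^n⟮I; F, V⟯ :=
  ⟨fun f s ↦ ⟨⇑f • ⇑s, f.contMDiff.smul_section s.contMDiff⟩⟩

instance : Module C^n⟮I, M; 𝕜⟯ Cₛ^n⟮I; F, V⟯ where
  one_smul s := ContMDiffSection.ext fun x ↦ one_smul 𝕜 (s x)
  mul_smul f g s := ContMDiffSection.ext fun x ↦ mul_smul (f x) (g x) (s x)
  smul_zero f := ContMDiffSection.ext fun x ↦ smul_zero (f x)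
  smul_add f s t := ContMDiffSection.ext fun x ↦ smul_add (f x) (s x) (t x)
  add_smul f g s := ContMDiffSection.ext fun x ↦ add_smul (f x) (g x) (s x)
  zero_smul s := ContMDiffSection.ext fun x ↦ zero_smul 𝕜 (s x)

instance : IsScalarTower 𝕜 C^n⟮I, M; 𝕜⟯ Cₛ^n⟮I; F, V⟯ where
  smul_assoc c f s := ContMDiffSection.ext fun x ↦ smul_assoc c (f x) (s x)

/-- The sections of a vector bundle that vanish at the point `x`. -/
def sectionsVanishingAt (x : M) : AddSubgroup Cₛ^n⟮I; F, V⟯ :=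
  ((Pi.evalAddMonoidHom V x).comp (ContMDiffSection.coeAddHom I F n V)).ker

lemma mem_sectionsVanishingAt {x : M} {s : Cₛ^n⟮I; F, V⟯} :
    s ∈ sectionsVanishingAt x ↔ s x = 0 := Iff.rfl

end SmoothSections

section VectorFields

variable {E : Type*} [NormedAddCommGroup E] [NormedSpace ℝ E]
  {M : Type*} [TopologicalSpace M] [ChartedSpace E M] [IsManifold 𝓘(ℝ, E) ∞ M]

local instance : IsManifold 𝓘(ℝ, E) (minSmoothness ℝ 2) M := by
  rw [minSmoothness_of_isRCLikeNormedField]; infer_instance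

local instance : IsManifold 𝓘(ℝ, E) (minSmoothness ℝ 3) M := by
  rw [minSmoothness_of_isRCLikeNormedField]; infer_instance

local instance : IsManifold 𝓘(ℝ, E) (∞ + 1) M := inferInstanceAs (IsManifold 𝓘(ℝ, E) ∞ M)

variable (E M) in
/-- The smooth vector fields on `M`, bundled. -/
abbrev SmoothVectorField := Cₛ^∞⟮𝓘(ℝ, E); E, (TangentSpace 𝓘(ℝ, E) : M → Type _)⟯

instance : IsAddTorsionFree (SmoothVectorField E M) := .of_isTorsionFree ℝ _

instance : IsAddTorsionFree C^∞⟮𝓘(ℝ, E), M; ℝ⟯ := .of_isTorsionFree ℝ _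

lemma minSmoothness_two_le_infty : minSmoothness ℝ 2 ≤ ∞ := by
  rw [minSmoothness_of_isRCLikeNormedField]; exact ENat.LEInfty.out

section LieBracket

variable [CompleteSpace E]

instance : Bracket (SmoothVectorField E M) (SmoothVectorField E M) :=
  ⟨fun X Y ↦ ⟨mlieBracket 𝓘(ℝ, E) X Y,
    ContDiff.mlieBracket_vectorField (m := ⊤) (n := ⊤) X.contMDiff Y.contMDiff (by simp)⟩⟩

instance : LieRing (SmoothVectorField E M) where
  add_lie X X' _ := ContMDiffSection.ext fun _ ↦
    mlieBracket_add_left X.mdifferentiableAt X'.mdifferentiableAt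
  lie_add _ Y Y' := ContMDiffSection.ext fun _ ↦
    mlieBracket_add_right Y.mdifferentiableAt Y'.mdifferentiableAt
  lie_self _ := ContMDiffSection.ext fun _ ↦ congrFun mlieBracket_self _
  leibniz_lie X Y Z := ContMDiffSection.ext fun _ ↦ leibniz_identity_mlieBracket_apply
    (X.contMDiff.contMDiffAt.of_le minSmoothness_two_le_infty)
    (Y.contMDiff.contMDiffAt.of_le minSmoothness_two_le_infty)
    (Z.contMDiff.contMDiffAt.of_le minSmoothness_two_le_infty)

instance : LieAlgebra ℝ (SmoothVectorField E M) where
  lie_smul _ _ Y := ContMDiffSection.ext fun _ ↦ mlieBracket_const_smul_right Y.mdifferentiableAt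

end LieBracket

lemma contMDiff_mvfderiv_apply (X : SmoothVectorField E M) (f : C^∞⟮𝓘(ℝ, E), M; ℝ⟯) :
    ContMDiff 𝓘(ℝ, E) 𝓘(ℝ, ℝ) ∞ fun x ↦ mvfderiv 𝓘(ℝ, E) f x (X x) :=
  (contMDiff_snd_tangentBundle_modelSpace ℝ 𝓘(ℝ, ℝ)).comp
    ((f.contMDiff.contMDiff_tangentMap (m := ∞) le_rfl).comp X.contMDiff)

instance : Bracket (SmoothVectorField E M) C^∞⟮𝓘(ℝ, E), M; ℝ⟯ :=
  ⟨fun X f ↦ ⟨fun x ↦ mvfderiv 𝓘(ℝ, E) f x (X x), contMDiff_mvfderiv_apply X f⟩⟩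

lemma lie_function_apply (X : SmoothVectorField E M) (f : C^∞⟮𝓘(ℝ, E), M; ℝ⟯) (x : M) :
    ⁅X, f⁆ x = mvfderiv 𝓘(ℝ, E) f x (X x) := rfl

lemma lie_function_smul [CompleteSpace E] (X Y : SmoothVectorField E M)
    (f : C^∞⟮𝓘(ℝ, E), M; ℝ⟯) :
    ⁅X, f • Y⁆ = ⁅X, f⁆ • Y + f • ⁅X, Y⁆ :=
  ContMDiffSection.ext fun x ↦
    mlieBracket_smul_right (f.mdifferentiable x) Y.mdifferentiableAt

section Extension

variable [FiniteDimensional ℝ E] [T2Space M]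

lemma exists_smoothVectorField_apply_eq (x : M) (v : TangentSpace 𝓘(ℝ, E) x) :
    ∃ X : SmoothVectorField E M, X x = v := by
  obtain ⟨s, hs, hvs⟩ := FiberBundle.exists_contMDiffOn_extend (k := ∞) 𝓘(ℝ, E) E v
  obtain ⟨u, hus, hu, hxu⟩ := mem_nhds_iff.1 hs
  obtain ⟨f, -, hf⟩ := (SmoothBumpFunction.nhds_basis_tsupport (I := 𝓘(ℝ, E)) x).mem_iff.1
    (hu.mem_nhds hxu)
  refine ⟨⟨_, ContMDiffOn.smul_section_of_tsupport f.contMDiff.contMDiffOn hu hf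
    (hvs.mono hus)⟩, ?_⟩
  simp

lemma exists_smoothVectorField_apply_ne_zero [Nontrivial E] (x : M) :
    ∃ X : SmoothVectorField E M, X x ≠ 0 := by
  obtain ⟨v, hv⟩ : ∃ v : TangentSpace 𝓘(ℝ, E) x, v ≠ 0 := exists_ne (0 : E)
  obtain ⟨X, rfl⟩ := exists_smoothVectorField_apply_eq x v
  exact ⟨X, hv⟩

lemma sectionsVanishingAt_ne_top [Nontrivial E] (x : M) :
    (sectionsVanishingAt x : AddSubgroup (SmoothVectorField E M)) ≠ ⊤ := by
  obtain ⟨X, hX⟩ := exists_smoothVectorField_apply_ne_zero (E := E) x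
  exact fun h ↦ hX (mem_sectionsVanishingAt.1 (h ▸ AddSubgroup.mem_top X))

instance [Nontrivial E] : FaithfulSMul C^∞⟮𝓘(ℝ, E), M; ℝ⟯ (SmoothVectorField E M) where
  eq_of_smul_eq_smul {f g} h := by
    ext x
    obtain ⟨X, hX⟩ := exists_smoothVectorField_apply_ne_zero (E := E) x
    exact smul_left_injective ℝ hX (congrArg (fun Y : SmoothVectorField E M ↦ Y x) (h X))

lemma lie_lie_function (X Y : SmoothVectorField E M) (f : C^∞⟮𝓘(ℝ, E), M; ℝ⟯) :
    ⁅X, ⁅Y, f⁆⁆ = ⁅⁅X, Y⁆, f⁆ + ⁅Y, ⁅X, f⁆⁆ := by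
  rcases subsingleton_or_nontrivial E with hE | hE
  · have lie_eq_zero (Z : SmoothVectorField E M) (f : C^∞⟮𝓘(ℝ, E), M; ℝ⟯) : ⁅Z, f⁆ = 0 := by
      ext x
      rw [lie_function_apply, show Z x = 0 from hE.elim _ _, map_zero, ContMDiffMap.coe_zero,
        Pi.zero_apply]
    simp only [lie_eq_zero, add_zero]
  · refine FaithfulSMul.eq_of_smul_eq_smul (α := SmoothVectorField E M) fun Z ↦ ?_
    have jacobi := leibniz_lie X Y (f • Z)
    simp only [lie_function_smul, lie_add] at jacobi
    rw [leibniz_lie X Y Z] at jacobi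
    linear_combination (norm := module) jacobi

instance : LieRingModule (SmoothVectorField E M) C^∞⟮𝓘(ℝ, E), M; ℝ⟯ where
  add_lie X X' f := ContMDiffMap.ext fun x ↦ map_add (mvfderiv 𝓘(ℝ, E) f x) (X x) (X' x)
  lie_add X f f' := ContMDiffMap.ext fun x ↦ congrArg (fun A ↦ A (X x))
    (mvfderiv_add (f.mdifferentiable x) (f'.mdifferentiable x))
  leibniz_lie := lie_lie_function

end Extension

section Connection

variable {D : CovariantDerivative 𝓘(ℝ, E) E (fun x : M ↦ TangentSpace 𝓘(ℝ, E) x)}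
  (hD : D.ContMDiffCovariantDerivative ∞)

/-- A smooth connection `D`, as the map `X ↦ (Y ↦ D_X Y)` on smooth vector fields. -/
def connectionMap : SmoothVectorField E M →ₗ[ℝ] Module.End ℝ (SmoothVectorField E M) :=
  LinearMap.mk₂ ℝ
    (fun X Y ↦ ⟨fun x ↦ D Y x (X x), (contMDiffOn_univ.1
      (hD.contMDiff.contMDiff (σ := Y) Y.contMDiff.contMDiffOn)).clm_bundle_apply X.contMDiff⟩)
    (fun X X' Y ↦ ContMDiffSection.ext fun x ↦ map_add (D Y x) _ _)
    (fun c X Y ↦ ContMDiffSection.ext fun x ↦ map_smul (D Y x) _ _)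
    (fun X Y Y' ↦ ContMDiffSection.ext fun x ↦ congrArg (fun A ↦ A (X x))
      (D.isCovariantDerivativeOnUniv.add Y.mdifferentiableAt Y'.mdifferentiableAt))
    (fun c X Y ↦ ContMDiffSection.ext fun x ↦ congrArg (fun A ↦ A (X x))
      (D.isCovariantDerivativeOnUniv.smul_const c Y.mdifferentiableAt))

lemma connectionMap_smul (X Y : SmoothVectorField E M) (f : C^∞⟮𝓘(ℝ, E), M; ℝ⟯) :
    connectionMap hD X (f • Y) = f • connectionMap hD X Y + ⁅X, f⁆ • Y :=
  ContMDiffSection.ext fun x ↦ congrArg (fun A ↦ A (X x))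
    (D.isCovariantDerivativeOnUniv.leibniz Y.mdifferentiableAt (f.mdifferentiable x))

variable [FiniteDimensional ℝ E]

lemma torsionForm_connectionMap_apply (X Y : SmoothVectorField E M) (x : M) :
    torsionForm (connectionMap hD) X Y x = D.torsion x (X x) (Y x) :=
  (D.torsion_apply X.mdifferentiableAt Y.mdifferentiableAt).symm

end Connection

section Hermitian

variable [RiemannianBundle (fun x : M ↦ TangentSpace 𝓘(ℝ, E) x)]

/-- The almost complex structure, as an operator on smooth vector fields. -/
def complexStructureMap
    {J : (x : M) → TangentSpace 𝓘(ℝ, E) x →L[ℝ] TangentSpace 𝓘(ℝ, E) x}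
    (hJ : IsHermitianStructure J) :
    SmoothVectorField E M →ₗ[C^∞⟮𝓘(ℝ, E), M; ℝ⟯] SmoothVectorField E M where
  toFun X := ⟨applyField J X, hJ.smooth.clm_bundle_apply X.contMDiff⟩
  map_add' _ _ := ContMDiffSection.ext fun x ↦ map_add (J x) _ _
  map_smul' _ _ := ContMDiffSection.ext fun x ↦ map_smul (J x) _ _

variable [IsContMDiffRiemannianBundle 𝓘(ℝ, E) ∞ E (fun x : M ↦ TangentSpace 𝓘(ℝ, E) x)]

variable (E M) in
/-- The Riemannian metric, as a form on smooth vector fields with values in smooth functions. -/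
def metricForm : SmoothVectorField E M →ₗ[C^∞⟮𝓘(ℝ, E), M; ℝ⟯] SmoothVectorField E M
    →ₗ[C^∞⟮𝓘(ℝ, E), M; ℝ⟯] C^∞⟮𝓘(ℝ, E), M; ℝ⟯ :=
  LinearMap.mk₂ _
    (fun X Y ↦ ⟨fun x ↦ inner ℝ (X x) (Y x), ContMDiff.inner_bundle (F := E)
      (E := fun x : M ↦ TangentSpace 𝓘(ℝ, E) x) (b := id) X.contMDiff Y.contMDiff⟩)
    (fun X X' Y ↦ ContMDiffMap.ext fun x ↦ inner_add_left (X x) (X' x) (Y x))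
    (fun f X Y ↦ ContMDiffMap.ext fun x ↦ real_inner_smul_left (X x) (Y x) (f x))
    (fun X Y Y' ↦ ContMDiffMap.ext fun x ↦ inner_add_right (X x) (Y x) (Y' x))
    (fun f X Y ↦ ContMDiffMap.ext fun x ↦ real_inner_smul_right (X x) (Y x) (f x))

variable [FiniteDimensional ℝ E] [T2Space M]
  {J : (x : M) → TangentSpace 𝓘(ℝ, E) x →L[ℝ] TangentSpace 𝓘(ℝ, E) x}
  {D : CovariantDerivative 𝓘(ℝ, E) E (fun x : M ↦ TangentSpace 𝓘(ℝ, E) x)}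
  (hJ : IsHermitianStructure J) (hD : IsChernConnection J D)

theorem isAlgebraicChernConnection_connectionMap : IsAlgebraicChernConnection (metricForm E M)
    (complexStructureMap hJ) (connectionMap hD.smooth) where
  sq_eq_neg X := ContMDiffSection.ext fun x ↦ hJ.sq_eq_neg x (X x)
  nijenhuis_eq_zero X Y := ContMDiffSection.ext fun x ↦
    hJ.nijenhuis_eq_zero X Y X.contMDiff Y.contMDiff x
  symm X Y := ContMDiffMap.ext fun x ↦ real_inner_comm (Y x) (X x)
  orthogonal X Y := ContMDiffMap.ext fun x ↦ hJ.orthogonal x (X x) (Y x)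
  separatingLeft X hX := ContMDiffSection.ext fun x ↦
    inner_self_eq_zero.1 (congrArg (fun f : C^∞⟮𝓘(ℝ, E), M; ℝ⟯ ↦ f x) (hX X))
  complex_parallel X Y := ContMDiffSection.ext fun x ↦
    hD.complex_parallel Y Y.contMDiff x (X x)
  torsion_one_one X Y := ContMDiffSection.ext fun x ↦ by
    rw [ContMDiffSection.coe_add, Pi.add_apply, torsionForm_connectionMap_apply,
      torsionForm_connectionMap_apply]
    exact hD.torsion_one_one x (X x) (Y x)
  leibniz := connectionMap_smul hD.smooth
  metric_parallel X Y Z := ContMDiffMap.ext fun x ↦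
    hD.metric_parallel Y Z Y.contMDiff Z.contMDiff x (X x)

include hJ in
theorem metricForm_curvatureForm_complex_self [Nontrivial E] {c : ℝ}
    (hc : HasConstantBisectionalCurvature J D c) (X Y : SmoothVectorField E M) :
    metricForm E M (curvatureForm (connectionMap hD.smooth) X (complexStructureMap hJ X) Y)
      (complexStructureMap hJ Y) = c • (metricForm E M X X * metricForm E M Y Y) := by
  let q (X Y : SmoothVectorField E M) : C^∞⟮𝓘(ℝ, E), M; ℝ⟯ :=
    metricForm E M (curvatureForm (connectionMap hD.smooth) X (complexStructureMap hJ X) Y)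
      (complexStructureMap hJ Y) - c • (metricForm E M X X * metricForm E M Y Y)
  have parallelogram_left (X X' Y : SmoothVectorField E M) :
      q (X + X') Y + q (X - X') Y = 2 • q X Y + 2 • q X' Y := by
    simp only [q, map_add, map_sub, LinearMap.add_apply, LinearMap.sub_apply, add_mul, sub_mul,
      smul_add, smul_sub]
    abel
  have parallelogram_right (X Y Y' : SmoothVectorField E M) :
      q X (Y + Y') + q X (Y - Y') = 2 • q X Y + 2 • q X Y' := by
    simp only [q, map_add, map_sub, LinearMap.add_apply, LinearMap.sub_apply, mul_add, mul_sub,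
      smul_add, smul_sub]
    abel
  ext x
  have of_notMem (X : SmoothVectorField E M) (hX : X ∉ sectionsVanishingAt x)
      (Y : SmoothVectorField E M) (hY : Y ∉ sectionsVanishingAt x) : q X Y x = 0 := by
    have h := hc X Y X.contMDiff Y.contMDiff x hX hY
    rw [bisectionalCurvature, ← real_inner_self_eq_norm_sq, ← real_inner_self_eq_norm_sq,
      div_eq_iff (mul_ne_zero (inner_self_ne_zero.2 hX) (inner_self_ne_zero.2 hY))] at h
    exact sub_eq_zero.2 h
  -- The parallelogram law carries the identity over to fields vanishing at `x`, without using
  -- that the curvature is a tensor.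
  have of_left_notMem (X : SmoothVectorField E M) (hX : X ∉ sectionsVanishingAt x)
      (Y : SmoothVectorField E M) : q X Y x = 0 :=
    eq_zero_of_parallelogram_of_forall_notMem (q := fun Y ↦ q X Y x)
      (fun Y Y' ↦ DFunLike.congr_fun (parallelogram_right X Y Y') x)
      (sectionsVanishingAt_ne_top x) (of_notMem X hX) Y
  exact sub_eq_zero.1 <| eq_zero_of_parallelogram_of_forall_notMem (q := fun X ↦ q X Y x)
    (fun X X' ↦ DFunLike.congr_fun (parallelogram_left X X' Y) x)
    (sectionsVanishingAt_ne_top x) (fun X hX ↦ of_left_notMem X hX Y) X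

end Hermitian

end VectorFields

lemma exists_ne_zero_inner_eq_zero {F : Type*} [NormedAddCommGroup F] [InnerProductSpace ℝ F]
    [FiniteDimensional ℝ F] (hF : 2 < Module.finrank ℝ F) (v w : F) :
    ∃ z : F, z ≠ 0 ∧ inner ℝ v z = 0 ∧ inner ℝ w z = 0 := by
  have h := LinearMap.ker_ne_bot_of_finrank_lt
    (f := (innerₛₗ ℝ v).prod (innerₛₗ ℝ w)) (by simpa using hF)
  obtain ⟨z, hz, hz₀⟩ := Submodule.exists_mem_ne_zero_of_ne_bot h
  have hz' := LinearMap.mem_ker.1 hz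
  exact ⟨z, hz₀, congrArg Prod.fst hz', congrArg Prod.snd hz'⟩

end HermitianGeometry

end

theorem theorem8p8 {E : Type*} [NormedAddCommGroup E] [NormedSpace ℝ E] [FiniteDimensional ℝ E]
    {M : Type*} [TopologicalSpace M] [T2Space M] [Nonempty M] [ChartedSpace E M]
    [IsManifold 𝓘(ℝ, E) ∞ M]
    [RiemannianBundle (fun x : M ↦ TangentSpace 𝓘(ℝ, E) x)]
    [IsContMDiffRiemannianBundle 𝓘(ℝ, E) ∞ E (fun x : M ↦ TangentSpace 𝓘(ℝ, E) x)]
    (n : ℕ) (hn : 2 ≤ n) (hdim : Module.finrank ℝ E = 2 * n)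
    (J : (x : M) → TangentSpace 𝓘(ℝ, E) x →L[ℝ] TangentSpace 𝓘(ℝ, E) x)
    (hJ : HermitianGeometry.IsHermitianStructure J)
    (D : CovariantDerivative 𝓘(ℝ, E) E (fun x : M ↦ TangentSpace 𝓘(ℝ, E) x))
    (hD : HermitianGeometry.IsChernConnection J D) :
    ¬ ∃ c : ℝ, c ≠ 0 ∧ HermitianGeometry.HasConstantBisectionalCurvature J D c := by
  rintro ⟨c, hc₀, hc⟩
  have hE : Nontrivial E := Module.nontrivial_of_finrank_pos (R := ℝ) (by omega)
  obtain ⟨x⟩ := ‹Nonempty M›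
  have hfin : FiniteDimensional ℝ (TangentSpace 𝓘(ℝ, E) x) :=
    inferInstanceAs (FiniteDimensional ℝ E)
  have hrank : Module.finrank ℝ (TangentSpace 𝓘(ℝ, E) x) = 2 * n := hdim
  obtain ⟨X, hX⟩ := HermitianGeometry.exists_smoothVectorField_apply_ne_zero (E := E) x
  obtain ⟨z, hz, hXz, hJXz⟩ :=
    HermitianGeometry.exists_ne_zero_inner_eq_zero (by omega) (X x) (J x (X x))
  obtain ⟨Z, rfl⟩ := HermitianGeometry.exists_smoothVectorField_apply_eq x z
  have chern := HermitianGeometry.isAlgebraicChernConnection_connectionMap hJ hD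
  have curvature_eq := chern.curvatureForm_eq_smul_complex
    (HermitianGeometry.metricForm_curvatureForm_complex_self hJ hD hc)
  have spanned : inner ℝ (X x) (X x) • Z x =
      inner ℝ (X x) (Z x) • X x + inner ℝ (J x (X x)) (Z x) • J x (X x) :=
    congrArg (fun s : HermitianGeometry.SmoothVectorField E M ↦ s x)
      (chern.self_smul_eq_add hc₀.isUnit curvature_eq X Z)
  rw [hXz, hJXz, zero_smul, zero_smul, add_zero] at spanned
  exact smul_ne_zero (inner_self_ne_zero.2 hX) hz spanned
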